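/- For $k\ge 1$ let $M_k(\mathbb C)$ be the $k\times k$ complex matrices with the Hilbert--Schmidt inner product $\langle X,Y\rangle=\mathrm{tr}[X^*Y]$. Let $m,n\ge 1$ be integers and let $\Phi:M_m(\mathbb C)\to M_n(\mathbb C)$ be a linear map, with adjoint $\Phi^\dagger:M_n(\mathbb C)\to M_m(\mathbb C)$ with respect to these inner products. Suppose that $\Phi$ is a Schwarz map, i.e. $\Phi(K^*K)\ge\Phi(K)^*\Phi(K)$ for all $K\in M_m(\mathbb C)$, and that $\Phi$ is sesquiunital, i.e. $\Phi(\mathbf 1)=\mathbf 1$ and $\Phi^\dagger(\mathbf 1)=\frac nm\mathbf 1$. Let $0\le s<1$ and $\frac1{2-s}\le q<1$. Then for every positive definite $A\in M_n(\mathbb C)$ and every invertible $B\in M_n(\mathbb C)$, $$\left(\frac nm\right)^{(2-s)q-1}\mathrm{tr}\big[(B^*A^{-s}B)^q\big]\ \ge\ \mathrm{tr}\big[(\Phi^\dagger(B)^*\,\Phi^\dagger(A)^{-s}\,\Phi^\dagger(B))^q\big].$$ -/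

import Mathlib

open scoped Matrix ComplexOrder MatrixOrder

namespace SesquiunitalSchwarz

/-- The Hilbert--Schmidt inner product `⟪X, Y⟫ = tr[X* Y]` on `k × k` complex matrices. -/
def hsInner {k : ℕ} (X Y : Matrix (Fin k) (Fin k) ℂ) : ℂ :=
  (Xᴴ * Y).trace

/-- The adjoint `Φ†` of a linear map `Φ : M_m(ℂ) → M_n(ℂ)` for the Hilbert--Schmidt inner
products, given by its matrix entries `(Φ† Y)_{ij} = ⟪E_ij, Φ† Y⟫ = ⟪Φ(E_ij), Y⟫`.  The two
lemmas that follow show that it is the adjoint. -/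
def hsAdjoint {m n : ℕ}
    (Φ : Matrix (Fin m) (Fin m) ℂ →ₗ[ℂ] Matrix (Fin n) (Fin n) ℂ) :
    Matrix (Fin n) (Fin n) ℂ →ₗ[ℂ] Matrix (Fin m) (Fin m) ℂ where
  toFun Y := Matrix.of fun i j => hsInner (Φ (Matrix.single i j 1)) Y
  map_add' Y Z := by
    ext i j
    simp [hsInner, mul_add]
  map_smul' c Y := by
    ext i j
    simp [hsInner]

/-- The defining property of the adjoint: `⟪X, Φ† Y⟫ = ⟪Φ X, Y⟫`. -/
theorem hsInner_hsAdjoint {m n : ℕ}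
    (Φ : Matrix (Fin m) (Fin m) ℂ →ₗ[ℂ] Matrix (Fin n) (Fin n) ℂ)
    (X : Matrix (Fin m) (Fin m) ℂ) (Y : Matrix (Fin n) (Fin n) ℂ) :
    hsInner X (hsAdjoint Φ Y) = hsInner (Φ X) Y := by
  induction X using Matrix.induction_on' with
  | h_zero => simp [hsInner]
  | h_add X₁ X₂ h₁ h₂ =>
    simp only [hsInner, map_add, Matrix.conjTranspose_add, add_mul, Matrix.trace_add] at *
    rw [h₁, h₂]
  | h_std_basis i j c =>
    have hc : Matrix.single i j c = c • Matrix.single i j (1 : ℂ) := by simp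
    have h1 : hsInner (Matrix.single i j (1 : ℂ)) (hsAdjoint Φ Y)
        = hsInner (Φ (Matrix.single i j 1)) Y := by
      simp [hsInner, hsAdjoint, Matrix.conjTranspose_single, Matrix.trace_single_mul]
    rw [hc, map_smul]
    simp only [hsInner, Matrix.conjTranspose_smul, Matrix.smul_mul, Matrix.trace_smul] at *
    rw [h1]

/-- The defining property determines the adjoint. -/
theorem eq_hsAdjoint {m n : ℕ}
    (Φ : Matrix (Fin m) (Fin m) ℂ →ₗ[ℂ] Matrix (Fin n) (Fin n) ℂ)
    (Ψ : Matrix (Fin n) (Fin n) ℂ →ₗ[ℂ] Matrix (Fin m) (Fin m) ℂ)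
    (h : ∀ X Y, hsInner X (Ψ Y) = hsInner (Φ X) Y) : Ψ = hsAdjoint Φ := by
  ext Y i j
  simp only [hsAdjoint, LinearMap.coe_mk,
    AddHom.coe_mk, Matrix.of_apply, ← h]
  simp [hsInner, Matrix.conjTranspose_single, Matrix.trace_single_mul]

/-- `Φ` is a Schwarz map: `Φ(K* K) ≥ Φ(K)* Φ(K)` for all `K`. -/
def IsSchwarzMap {m n : ℕ}
    (Φ : Matrix (Fin m) (Fin m) ℂ →ₗ[ℂ] Matrix (Fin n) (Fin n) ℂ) : Prop :=
  ∀ K : Matrix (Fin m) (Fin m) ℂ, (Φ (Kᴴ * K) - (Φ K)ᴴ * Φ K).PosSemidef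

/-- `Φ` is unital: `Φ(1) = 1`. -/
def IsUnital {m n : ℕ}
    (Φ : Matrix (Fin m) (Fin m) ℂ →ₗ[ℂ] Matrix (Fin n) (Fin n) ℂ) : Prop :=
  Φ 1 = 1

/-- `Φ : M_m(ℂ) → M_n(ℂ)` is semiunital: `Φ†(1) = (n / m) 1`. -/
def IsSemiunital {m n : ℕ}
    (Φ : Matrix (Fin m) (Fin m) ℂ →ₗ[ℂ] Matrix (Fin n) (Fin n) ℂ) : Prop :=
  hsAdjoint Φ 1 = ((n : ℂ) / (m : ℂ)) • (1 : Matrix (Fin m) (Fin m) ℂ)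

/-- `Φ` is sesquiunital: unital and semiunital. -/
def IsSesquiunital {m n : ℕ}
    (Φ : Matrix (Fin m) (Fin m) ℂ →ₗ[ℂ] Matrix (Fin n) (Fin n) ℂ) : Prop :=
  IsUnital Φ ∧ IsSemiunital Φ

end SesquiunitalSchwarz

/-! Write `r = 1/q - 1`, `Z = B* A^{-s} B`, and `Z'` for its counterpart built from `Φ†(A)`,
`Φ†(B)`. The trace Young inequality (`trace_rpow_le`) bounds `tr[Z'^q]` by `q t^{-r} tr[Z' D^{-r}] +
(1-q) t tr[D]` for every `t > 0` and positive definite `D`. Take `D = Φ†(C)` with `C = Z^q`: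
unitality gives `tr[D] = tr[Z^q]`, and `Z C^{-r} = Z^q`. What remains is the monotonicity of `tr[B*
A^{-s} B C^{-r}]` under `Φ†` with constant `(n/m)^{1-s-r}` (`powerForm_hsAdjoint_le`). It is dual to
a bound on `Φ` between spaces weighted by powers of `A, C` and of `Φ†(A), Φ†(C)`. The Schwarz
inequality gives that bound for exponents `(1,0)`, `(0,1)` and `(0,0)`, with constants `1`, `1`,
`n/m`; Stein--Weiss interpolation fills the triangle `s, r ≥ 0`, `s + r ≤ 1`, and `q ≥ 1/(2-s)`
places `(s,r)` in it. -/

namespace SesquiunitalSchwarz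

/-! ### Complex interpolation with a change of weights. -/

/-- Stein--Weiss interpolation of weighted bounds on a bilinear form. -/
theorem norm_bilin_le_of_weighted_endpoints {ι κ : Type*} [Fintype ι] [Fintype κ]
    (S : ι → κ → ℂ) {α₀ α₁ : ι → ℝ} {β₀ β₁ : κ → ℝ}
    (hα₀ : ∀ i, 0 < α₀ i) (hα₁ : ∀ i, 0 < α₁ i) (hβ₀ : ∀ j, 0 < β₀ j) (hβ₁ : ∀ j, 0 < β₁ j)
    (h₀ : ∀ (g : ι → ℂ) (u : κ → ℂ), ‖∑ i, ∑ j, g i * S i j * u j‖ ≤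
      √((∑ i, α₀ i * ‖g i‖ ^ 2) * ∑ j, β₀ j * ‖u j‖ ^ 2))
    (h₁ : ∀ (g : ι → ℂ) (u : κ → ℂ), ‖∑ i, ∑ j, g i * S i j * u j‖ ≤
      √((∑ i, α₁ i * ‖g i‖ ^ 2) * ∑ j, β₁ j * ‖u j‖ ^ 2))
    {θ : ℝ} (hθ₀ : 0 ≤ θ) (hθ₁ : θ ≤ 1) (g : ι → ℂ) (u : κ → ℂ) :
    ‖∑ i, ∑ j, g i * S i j * u j‖ ≤
      √((∑ i, (α₀ i ^ (1 - θ) * α₁ i ^ θ) * ‖g i‖ ^ 2) *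
        ∑ j, (β₀ j ^ (1 - θ) * β₁ j ^ θ) * ‖u j‖ ^ 2) := by
  -- The twist `(a/b)^{(z-θ)/2}` turns the weight `a` on `Re z = 0`, and `b` on `Re z = 1`, into the
  -- interpolated weight; at `z = θ` it is trivial.
  have key₀ : ∀ a b : ℝ, 0 < a → 0 < b → ∀ (x : ℂ) (z : ℂ), z.re = 0 →
      a * ‖x * Complex.exp ((z - θ) * ((Real.log a - Real.log b) / 2 : ℝ))‖ ^ 2 =
        a ^ (1 - θ) * b ^ θ * ‖x‖ ^ 2 := by
    intro a b ha hb x z hz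
    rw [norm_mul, Complex.norm_exp, mul_pow, ← Real.exp_nat_mul, Real.rpow_def_of_pos ha,
      Real.rpow_def_of_pos hb, ← Real.exp_add]
    nth_rewrite 1 [← Real.exp_log ha]
    rw [mul_left_comm, ← Real.exp_add, mul_comm]
    congr 2
    rw [Complex.re_mul_ofReal]
    simp [hz]
    ring
  have key₁ : ∀ a b : ℝ, 0 < a → 0 < b → ∀ (x : ℂ) (z : ℂ), z.re = 1 →
      b * ‖x * Complex.exp ((z - θ) * ((Real.log a - Real.log b) / 2 : ℝ))‖ ^ 2 =
        a ^ (1 - θ) * b ^ θ * ‖x‖ ^ 2 := by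
    intro a b ha hb x z hz
    rw [norm_mul, Complex.norm_exp, mul_pow, ← Real.exp_nat_mul, Real.rpow_def_of_pos ha,
      Real.rpow_def_of_pos hb, ← Real.exp_add]
    nth_rewrite 1 [← Real.exp_log hb]
    rw [mul_left_comm, ← Real.exp_add, mul_comm]
    congr 2
    rw [Complex.re_mul_ofReal]
    simp [hz]
    ring
  set c : ι → ℝ := fun i => (Real.log (α₀ i) - Real.log (α₁ i)) / 2 with hc
  set d : κ → ℝ := fun j => (Real.log (β₀ j) - Real.log (β₁ j)) / 2 with hd
  set N : ℝ := √((∑ i, (α₀ i ^ (1 - θ) * α₁ i ^ θ) * ‖g i‖ ^ 2) *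
        ∑ j, (β₀ j ^ (1 - θ) * β₁ j ^ θ) * ‖u j‖ ^ 2) with hN
  -- `F θ` is the form to be bounded, and both boundary lines carry the same bound `N`, so the three
  -- lines theorem returns `N`.
  set F : ℂ → ℂ := fun z => ∑ i, ∑ j,
    (g i * Complex.exp ((z - θ) * (c i : ℝ))) * S i j *
      (u j * Complex.exp ((z - θ) * (d j : ℝ))) with hF
  have hdiff : DiffContOnCl ℂ F (Complex.HadamardThreeLines.verticalStrip 0 1) := by
    apply Differentiable.diffContOnCl
    rw [hF]
    fun_prop
  have hexp : ∀ (e : ℝ) (z : ℂ), z ∈ Complex.HadamardThreeLines.verticalClosedStrip 0 1 →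
      ‖Complex.exp ((z - θ) * (e : ℝ))‖ ≤ Real.exp |e| := by
    intro e z hz
    have hz' : 0 ≤ z.re ∧ z.re ≤ 1 := hz
    rw [Complex.norm_exp, Complex.re_mul_ofReal]
    refine Real.exp_le_exp.2 ((le_abs_self _).trans ?_)
    rw [abs_mul]
    refine mul_le_of_le_one_left (abs_nonneg e) ?_
    rw [abs_le]
    simp
    constructor <;> linarith [hz'.1, hz'.2]
  have hbdd : BddAbove ((norm ∘ F) '' Complex.HadamardThreeLines.verticalClosedStrip 0 1) := by
    refine ⟨∑ i, ∑ j, (‖g i‖ * Real.exp |c i|) * ‖S i j‖ * (‖u j‖ * Real.exp |d j|), ?_⟩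
    rintro _ ⟨z, hz, rfl⟩
    simp only [Function.comp_apply, hF]
    refine (norm_sum_le _ _).trans (Finset.sum_le_sum fun i _ => ?_)
    refine (norm_sum_le _ _).trans (Finset.sum_le_sum fun j _ => ?_)
    simp only [norm_mul]
    have := hexp (c i) z hz
    have := hexp (d j) z hz
    gcongr
  have hb₀ : ∀ z ∈ Complex.re ⁻¹' {0}, ‖F z‖ ≤ N := by
    intro z hz
    refine (h₀ _ _).trans_eq ?_
    rw [hN]
    congr 2
    · exact Finset.sum_congr rfl fun i _ => key₀ _ _ (hα₀ i) (hα₁ i) _ z hz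
    · exact Finset.sum_congr rfl fun j _ => key₀ _ _ (hβ₀ j) (hβ₁ j) _ z hz
  have hb₁ : ∀ z ∈ Complex.re ⁻¹' {1}, ‖F z‖ ≤ N := by
    intro z hz
    refine (h₁ _ _).trans_eq ?_
    rw [hN]
    congr 2
    · exact Finset.sum_congr rfl fun i _ => key₁ _ _ (hα₀ i) (hα₁ i) _ z hz
    · exact Finset.sum_congr rfl fun j _ => key₁ _ _ (hβ₀ j) (hβ₁ j) _ z hz
  have hz : (θ : ℂ) ∈ Complex.HadamardThreeLines.verticalClosedStrip 0 1 := by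
    simpa [Complex.HadamardThreeLines.verticalClosedStrip] using ⟨hθ₀, hθ₁⟩
  have h := Complex.HadamardThreeLines.norm_le_interp_of_mem_verticalClosedStrip' zero_lt_one hz hdiff hbdd
    hb₀ hb₁
  rw [Complex.ofReal_re, sub_zero, sub_zero, div_one, ← Real.rpow_add_of_nonneg (Real.sqrt_nonneg _) (by linarith) hθ₀,
    sub_add_cancel, Real.rpow_one] at h
  simpa [hF] using h

/-! ### Matrix powers and trace forms in eigenbases. -/

/-- Powers of a positive semidefinite matrix in an eigenbasis. -/
theorem exists_unitary_rpow_eq {n : ℕ} {A : Matrix (Fin n) (Fin n) ℂ} (hA : A.PosSemidef) :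
    ∃ (U : Matrix (Fin n) (Fin n) ℂ) (d : Fin n → ℝ), U * Uᴴ = 1 ∧ Uᴴ * U = 1 ∧
      (∀ i, 0 ≤ d i) ∧ (A.PosDef → ∀ i, 0 < d i) ∧
      ∀ a : ℝ, A ^ a = U * Matrix.diagonal (fun i => ((d i ^ a : ℝ) : ℂ)) * Uᴴ := by
  refine ⟨hA.1.eigenvectorUnitary, hA.1.eigenvalues,
    Unitary.mul_star_self_of_mem hA.1.eigenvectorUnitary.2,
    Unitary.star_mul_self_of_mem hA.1.eigenvectorUnitary.2, hA.eigenvalues_nonneg,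
    fun h => h.eigenvalues_pos, fun a => ?_⟩
  rw [CFC.rpow_eq_cfc_real (Matrix.nonneg_iff_posSemidef.2 hA), hA.1.cfc_eq]
  simp [Matrix.IsHermitian.cfc, Unitary.conjStarAlgAut_apply, Function.comp_def,
    Matrix.star_eq_conjTranspose]

/-- The quadratic form `tr[K* P K Q]` in eigenbases of `P` and `Q`. -/
theorem trace_sandwich_eq_sum {n : ℕ} (U V K : Matrix (Fin n) (Fin n) ℂ) (d e : Fin n → ℝ) :
    (Kᴴ * (U * Matrix.diagonal (fun i => (d i : ℂ)) * Uᴴ) * K *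
      (V * Matrix.diagonal (fun i => (e i : ℂ)) * Vᴴ)).trace =
      ((∑ i, ∑ j, d i * e j * ‖(Uᴴ * K * V) i j‖ ^ 2 : ℝ) : ℂ) := by
  have h : (Kᴴ * (U * Matrix.diagonal (fun i => (d i : ℂ)) * Uᴴ) * K *
      (V * Matrix.diagonal (fun i => (e i : ℂ)) * Vᴴ)).trace =
      ((Uᴴ * K * V)ᴴ * (Matrix.diagonal (fun i => (d i : ℂ)) * (Uᴴ * K * V) *
        Matrix.diagonal (fun i => (e i : ℂ)))).trace := by
    simp only [Matrix.conjTranspose_mul, Matrix.conjTranspose_conjTranspose, ← Matrix.mul_assoc]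
    rw [Matrix.trace_mul_comm]
    simp only [← Matrix.mul_assoc]
  rw [h, Finset.sum_comm]
  simp only [Matrix.trace, Matrix.diag_apply, Matrix.mul_apply (M := (Uᴴ * K * V)ᴴ),
    Matrix.mul_diagonal, Matrix.diagonal_mul, Matrix.conjTranspose_apply]
  push_cast
  refine Finset.sum_congr rfl fun i _ => Finset.sum_congr rfl fun j _ => ?_
  rw [← Complex.conj_mul', Complex.star_def]
  ring

theorem rpow_one_and_rpow_zero {n : ℕ} {A : Matrix (Fin n) (Fin n) ℂ}
    (hA : A.PosSemidef) : A ^ (1 : ℝ) = A ∧ A ^ (0 : ℝ) = 1 :=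
  ⟨CFC.rpow_one A (Matrix.nonneg_iff_posSemidef.2 hA),
    CFC.rpow_zero A (Matrix.nonneg_iff_posSemidef.2 hA)⟩

theorem trace_mul_nonneg_of_posSemidef {n : ℕ} {P Q : Matrix (Fin n) (Fin n) ℂ}
    (hP : P.PosSemidef) (hQ : Q.PosSemidef) : 0 ≤ (P * Q).trace := by
  have h : CFC.sqrt P * CFC.sqrt P = P :=
    CFC.sqrt_mul_sqrt_self P (Matrix.nonneg_iff_posSemidef.2 hP)
  have hs : (CFC.sqrt P)ᴴ = CFC.sqrt P :=
    (Matrix.nonneg_iff_posSemidef.1 (CFC.sqrt_nonneg P)).1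
  rw [← h, Matrix.mul_assoc, Matrix.trace_mul_comm, Matrix.mul_assoc, ← Matrix.mul_assoc]
  nth_rewrite 1 [← hs]
  exact (hQ.conjTranspose_mul_mul_same _).trace_nonneg

theorem trace_conjTranspose_mul_eq_sum {n : ℕ} {U V : Matrix (Fin n) (Fin n) ℂ}
    (hU : U * Uᴴ = 1) (hV : V * Vᴴ = 1) (B X : Matrix (Fin n) (Fin n) ℂ) :
    (Bᴴ * X).trace =
      ∑ p : Fin n × Fin n, star ((Uᴴ * B * V) p.1 p.2) * (Uᴴ * X * V) p.1 p.2 := by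
  have h : (Bᴴ * X).trace = ((Uᴴ * B * V)ᴴ * (Uᴴ * X * V)).trace := by
    calc (Bᴴ * X).trace = (Bᴴ * (U * Uᴴ) * X * (V * Vᴴ)).trace := by simp [hU, hV]
      _ = _ := by
        simp only [Matrix.conjTranspose_mul, Matrix.conjTranspose_conjTranspose,
          ← Matrix.mul_assoc]
        rw [Matrix.trace_mul_comm]
        simp only [← Matrix.mul_assoc]
  rw [h, Fintype.sum_prod_type, Finset.sum_comm]
  simp only [Matrix.trace, Matrix.diag_apply, Matrix.mul_apply (M := (Uᴴ * B * V)ᴴ),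
    Matrix.conjTranspose_apply]

/-- `tr[K* A^a K C^b]`. -/
noncomputable def powerForm {n : ℕ} (A C : Matrix (Fin n) (Fin n) ℂ) (a b : ℝ)
    (K : Matrix (Fin n) (Fin n) ℂ) : ℝ :=
  (Kᴴ * A ^ a * K * C ^ b).trace.re

/-- Simultaneous eigenbases that diagonalize all the forms `tr[K* A^a K C^b]`. -/
theorem exists_powerForm_eq_sum {n : ℕ} {A C : Matrix (Fin n) (Fin n) ℂ}
    (hA : A.PosDef) (hC : C.PosDef) :
    ∃ (U V : Matrix (Fin n) (Fin n) ℂ) (d e : Fin n → ℝ),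
      (U * Uᴴ = 1 ∧ Uᴴ * U = 1) ∧ (V * Vᴴ = 1 ∧ Vᴴ * V = 1) ∧ (∀ i, 0 < d i) ∧ (∀ i, 0 < e i) ∧
      ∀ a b K, powerForm A C a b K =
        ∑ p : Fin n × Fin n, (d p.1 ^ a * e p.2 ^ b) * ‖(Uᴴ * K * V) p.1 p.2‖ ^ 2 := by
  obtain ⟨U, d, hU, hU', -, hd, hUd⟩ := exists_unitary_rpow_eq hA.posSemidef
  obtain ⟨V, e, hV, hV', -, he, hVe⟩ := exists_unitary_rpow_eq hC.posSemidef
  refine ⟨U, V, d, e, ⟨hU, hU'⟩, ⟨hV, hV'⟩, hd hA, he hC, fun a b K => ?_⟩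
  rw [powerForm, hUd, hVe, trace_sandwich_eq_sum, Complex.ofReal_re, Fintype.sum_prod_type]

theorem powerForm_nonneg {n : ℕ} {A C : Matrix (Fin n) (Fin n) ℂ} (hA : A.PosDef)
    (hC : C.PosDef) (a b : ℝ) (K : Matrix (Fin n) (Fin n) ℂ) : 0 ≤ powerForm A C a b K := by
  obtain ⟨U, V, d, e, -, -, hd, he, h⟩ := exists_powerForm_eq_sum hA hC
  rw [h]
  refine Finset.sum_nonneg fun p _ => ?_
  have := hd p.1
  have := he p.2
  positivity

/-- Cauchy--Schwarz for dual weights. -/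
theorem norm_trace_le_sqrt_powerForm {n : ℕ} {A C : Matrix (Fin n) (Fin n) ℂ}
    (hA : A.PosDef) (hC : C.PosDef) (a b : ℝ) (B X : Matrix (Fin n) (Fin n) ℂ) :
    ‖(Bᴴ * X).trace‖ ≤ √(powerForm A C (-a) (-b) B * powerForm A C a b X) := by
  obtain ⟨U, V, d, e, hU, hV, hd, he, h⟩ := exists_powerForm_eq_sum hA hC
  rw [trace_conjTranspose_mul_eq_sum hU.1 hV.1, h, h, Real.sqrt_mul]
  · refine (norm_sum_le _ _).trans (le_trans (Finset.sum_le_sum fun p _ => ?_)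
      (Real.sum_sqrt_mul_sqrt_le _ (fun p => ?_) (fun p => ?_)))
    · have hd' := Real.rpow_pos_of_pos (hd p.1) a
      have he' := Real.rpow_pos_of_pos (he p.2) b
      rw [← Real.sqrt_mul, Real.rpow_neg (hd _).le, Real.rpow_neg (he _).le, norm_mul, norm_star]
      · apply Real.le_sqrt_of_sq_le
        apply le_of_eq
        field_simp
      · have := hd p.1
        have := he p.2
        positivity
    · have := hd p.1
      have := he p.2
      positivity
    · have := hd p.1
      have := he p.2
      positivity
  · refine Finset.sum_nonneg fun p _ => ?_
    have := hd p.1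
    have := he p.2
    positivity

/-! ### Weighted bounds on `Φ` and their interpolation. -/

section Bounds

variable {m n : ℕ} {Φ : Matrix (Fin m) (Fin m) ℂ →ₗ[ℂ] Matrix (Fin n) (Fin n) ℂ}

/-- The sesquilinear form of `Φ` is bounded, with squared constant `k`, for the weights
`A^{-a}, C^{-b}` on the target and `A'^a, C'^b` on the source. -/
def WeightedBound (Φ : Matrix (Fin m) (Fin m) ℂ →ₗ[ℂ] Matrix (Fin n) (Fin n) ℂ)
    (A C : Matrix (Fin n) (Fin n) ℂ) (A' C' : Matrix (Fin m) (Fin m) ℂ) (a b k : ℝ) : Prop :=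
  ∀ B K, ‖(Bᴴ * Φ K).trace‖ ≤ √(powerForm A C (-a) (-b) B * (k * powerForm A' C' a b K))

theorem weightedBound_of_powerForm_le {A C : Matrix (Fin n) (Fin n) ℂ}
    {A' C' : Matrix (Fin m) (Fin m) ℂ} (hA : A.PosDef) (hC : C.PosDef) {a b k : ℝ}
    (h : ∀ K, powerForm A C a b (Φ K) ≤ k * powerForm A' C' a b K) :
    WeightedBound Φ A C A' C' a b k := by
  intro B K
  refine (norm_trace_le_sqrt_powerForm hA hC a b B (Φ K)).trans (Real.sqrt_le_sqrt ?_)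
  exact mul_le_mul_of_nonneg_left (h K) (powerForm_nonneg hA hC _ _ _)

/-- Interpolation of weighted bounds. -/
theorem WeightedBound.interpolate {A C : Matrix (Fin n) (Fin n) ℂ}
    {A' C' : Matrix (Fin m) (Fin m) ℂ} (hA : A.PosDef) (hC : C.PosDef)
    (hA' : A'.PosDef) (hC' : C'.PosDef) {a₀ b₀ k₀ a₁ b₁ k₁ : ℝ} (hk₀ : 0 < k₀) (hk₁ : 0 < k₁)
    (h₀ : WeightedBound Φ A C A' C' a₀ b₀ k₀) (h₁ : WeightedBound Φ A C A' C' a₁ b₁ k₁)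
    {θ : ℝ} (hθ₀ : 0 ≤ θ) (hθ₁ : θ ≤ 1) :
    WeightedBound Φ A C A' C' ((1 - θ) * a₀ + θ * a₁) ((1 - θ) * b₀ + θ * b₁)
      (k₀ ^ (1 - θ) * k₁ ^ θ) := by
  obtain ⟨U, V, d, e, ⟨hU, hU'⟩, ⟨hV, hV'⟩, hd, he, h⟩ := exists_powerForm_eq_sum hA hC
  obtain ⟨U', V', d', e', ⟨hW, hW'⟩, ⟨hX, hX'⟩, hd', he', h'⟩ := exists_powerForm_eq_sum hA' hC'
  -- `Φ` in eigenbasis coordinates, where all the weights are diagonal and the scalar interpolation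
  -- theorem applies.
  let T : (Fin m × Fin m → ℂ) →ₗ[ℂ] (Fin n × Fin n → ℂ) :=
    { toFun := fun u p => (Uᴴ * Φ (U' * Matrix.of (fun i j => u (i, j)) * V'ᴴ) * V) p.1 p.2
      map_add' := by
        intro u v
        ext p
        change (Uᴴ * Φ (U' * (Matrix.of (fun i j => u (i, j)) + Matrix.of (fun i j => v (i, j))) *
          V'ᴴ) * V) p.1 p.2 = _ + _
        rw [Matrix.mul_add, Matrix.add_mul, map_add, Matrix.mul_add, Matrix.add_mul]
        rfl
      map_smul' := by
        intro c u
        ext p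
        change (Uᴴ * Φ (U' * (c • Matrix.of (fun i j => u (i, j))) * V'ᴴ) * V) p.1 p.2 = c * _
        rw [Matrix.mul_smul, Matrix.smul_mul, map_smul, Matrix.mul_smul, Matrix.smul_mul]
        rfl }
  have hT : ∀ u p, T u p = (Uᴴ * Φ (U' * Matrix.of (fun i j => u (i, j)) * V'ᴴ) * V) p.1 p.2 :=
    fun u p => rfl
  have hsum : ∀ (g : Fin n × Fin n → ℂ) (u : Fin m × Fin m → ℂ),
      ∑ p, ∑ q, g p * LinearMap.toMatrix' T p q * u q = ∑ p, g p * T u p := by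
    intro g u
    refine Finset.sum_congr rfl fun p _ => ?_
    rw [← LinearMap.toMatrix'_mulVec T u, Matrix.mulVec, dotProduct, Finset.mul_sum]
    exact Finset.sum_congr rfl fun q _ => mul_assoc _ _ _
  have hcoord : ∀ a b k, WeightedBound Φ A C A' C' a b k → ∀ (g : Fin n × Fin n → ℂ) (u : Fin m × Fin m → ℂ),
      ‖∑ p, ∑ q, g p * LinearMap.toMatrix' T p q * u q‖ ≤
        √((∑ p, (d p.1 ^ (-a) * e p.2 ^ (-b)) * ‖g p‖ ^ 2) *
          ∑ q, (k * (d' q.1 ^ a * e' q.2 ^ b)) * ‖u q‖ ^ 2) := by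
    intro a b k hb g u
    -- The conjugate of `g` enters because the trace pairing is conjugate-linear in `B`, whereas the
    -- interpolated form is bilinear.
    have hB := hb (U * Matrix.of (fun i j => star (g (i, j))) * Vᴴ)
      (U' * Matrix.of (fun i j => u (i, j)) * V'ᴴ)
    have e₁ : Uᴴ * (U * Matrix.of (fun i j => star (g (i, j))) * Vᴴ) * V =
        Matrix.of (fun i j => star (g (i, j))) := by
      calc _ = (Uᴴ * U) * Matrix.of (fun i j => star (g (i, j))) * (Vᴴ * V) := by
            simp only [Matrix.mul_assoc]
        _ = _ := by rw [hU', hV', Matrix.one_mul, Matrix.mul_one]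
    have e₂ : U'ᴴ * (U' * Matrix.of (fun i j => u (i, j)) * V'ᴴ) * V' =
        Matrix.of (fun i j => u (i, j)) := by
      calc _ = (U'ᴴ * U') * Matrix.of (fun i j => u (i, j)) * (V'ᴴ * V') := by
            simp only [Matrix.mul_assoc]
        _ = _ := by rw [hW', hX', Matrix.one_mul, Matrix.mul_one]
    rw [trace_conjTranspose_mul_eq_sum hU hV, h, h', e₁, e₂] at hB
    simp only [Matrix.of_apply, star_star, norm_star] at hB
    have e₃ : ∑ q, (k * (d' q.1 ^ a * e' q.2 ^ b)) * ‖u q‖ ^ 2 =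
        k * ∑ q, (d' q.1 ^ a * e' q.2 ^ b) * ‖u q‖ ^ 2 := by
      simp only [Finset.mul_sum, mul_assoc]
    rw [hsum, e₃]
    exact hB
  intro B K
  have key := norm_bilin_le_of_weighted_endpoints (LinearMap.toMatrix' T)
    (fun p => mul_pos (Real.rpow_pos_of_pos (hd p.1) (-a₀)) (Real.rpow_pos_of_pos (he p.2) (-b₀)))
    (fun p => mul_pos (Real.rpow_pos_of_pos (hd p.1) (-a₁)) (Real.rpow_pos_of_pos (he p.2) (-b₁)))
    (fun q => mul_pos hk₀ (mul_pos (Real.rpow_pos_of_pos (hd' q.1) a₀)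
      (Real.rpow_pos_of_pos (he' q.2) b₀)))
    (fun q => mul_pos hk₁ (mul_pos (Real.rpow_pos_of_pos (hd' q.1) a₁)
      (Real.rpow_pos_of_pos (he' q.2) b₁)))
    (hcoord a₀ b₀ k₀ h₀) (hcoord a₁ b₁ k₁ h₁) hθ₀ hθ₁
    (fun p => star ((Uᴴ * B * V) p.1 p.2)) (fun q => (U'ᴴ * K * V') q.1 q.2)
  have hK : U' * Matrix.of (fun i j => (U'ᴴ * K * V') i j) * V'ᴴ = K := by
    change U' * (U'ᴴ * K * V') * V'ᴴ = K
    calc _ = (U' * U'ᴴ) * K * (V' * V'ᴴ) := by simp only [Matrix.mul_assoc]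
      _ = _ := by rw [hW, hX, Matrix.one_mul, Matrix.mul_one]
  have hpow : ∀ x y : ℝ, 0 < x → 0 < y → ∀ a b a' b' : ℝ,
      (x ^ a * y ^ b) ^ (1 - θ) * (x ^ a' * y ^ b') ^ θ =
        x ^ ((1 - θ) * a + θ * a') * y ^ ((1 - θ) * b + θ * b') := by
    intro x y hx hy a b a' b'
    rw [Real.mul_rpow (by positivity) (by positivity), Real.mul_rpow (by positivity) (by positivity),
      ← Real.rpow_mul hx.le, ← Real.rpow_mul hx.le, ← Real.rpow_mul hy.le, ← Real.rpow_mul hy.le,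
      Real.rpow_add hx, Real.rpow_add hy, mul_comm a, mul_comm a', mul_comm b, mul_comm b']
    ring
  rw [hsum] at key
  simp only [hT, hK] at key
  rw [← trace_conjTranspose_mul_eq_sum hU hV] at key
  refine key.trans_eq ?_
  rw [h, h']
  refine congrArg Real.sqrt (congrArg₂ (· * ·) ?_ ?_)
  · refine Finset.sum_congr rfl fun p _ => ?_
    rw [hpow _ _ (hd _) (he _), norm_star]
    congr 3 <;> ring
  · rw [Finset.mul_sum]
    refine Finset.sum_congr rfl fun q _ => ?_
    have := hd' q.1
    have := he' q.2
    rw [Real.mul_rpow hk₀.le (by positivity), Real.mul_rpow hk₁.le (by positivity),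
      mul_mul_mul_comm, hpow _ _ (hd' _) (he' _)]
    ring

end Bounds

/-! ### Schwarz maps: positivity, endpoint bounds, monotonicity. -/

section Schwarz

variable {m n : ℕ} {Φ : Matrix (Fin m) (Fin m) ℂ →ₗ[ℂ] Matrix (Fin n) (Fin n) ℂ}

theorem IsSchwarzMap.posSemidef_map_conjTranspose_mul_self (hΦ : IsSchwarzMap Φ)
    (K : Matrix (Fin m) (Fin m) ℂ) : (Φ (Kᴴ * K)).PosSemidef := by
  have h := (hΦ K).add (Matrix.posSemidef_conjTranspose_mul_self (Φ K))
  rwa [sub_add_cancel] at h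

/-- Polarization: `Φ` is Hermitian on `K*K`, `1`, `(K+1)*(K+1)` and `(K+i)*(K+i)`, and these isolate
`K` and `K*`. -/
theorem IsSchwarzMap.map_conjTranspose (hΦ : IsSchwarzMap Φ) (K : Matrix (Fin m) (Fin m) ℂ) :
    Φ Kᴴ = (Φ K)ᴴ := by
  have h0 := (hΦ.posSemidef_map_conjTranspose_mul_self K).1
  have h1 := (hΦ.posSemidef_map_conjTranspose_mul_self 1).1
  have h2 := (hΦ.posSemidef_map_conjTranspose_mul_self (K + 1)).1
  have h3 := (hΦ.posSemidef_map_conjTranspose_mul_self (K + Complex.I • 1)).1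
  simp only [Matrix.IsHermitian, Matrix.conjTranspose_add, Matrix.conjTranspose_one, mul_one,
    Matrix.conjTranspose_smul, add_mul, mul_add, one_mul, map_add, map_smul, smul_mul_assoc,
    mul_smul_comm, Complex.star_def, Complex.conj_I, neg_mul, neg_smul,
    neg_neg, map_neg, Matrix.conjTranspose_neg] at h0 h1 h2 h3
  rw [h0, h1] at h2 h3
  ext i j
  have e2 := congrFun (congrFun h2 i) j
  have e3 := congrFun (congrFun h3 i) j
  simp only [Matrix.add_apply, Matrix.neg_apply, Matrix.smul_apply, smul_eq_mul] at e2 e3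
  linear_combination (-1 / 2 : ℂ) * e2 + (Complex.I / 2) * e3 +
    ((Φ Kᴴ)ᴴ i j / 2 - (Φ K)ᴴ i j / 2 - (Φ K) i j / 2 + (Φ Kᴴ) i j / 2) * Complex.I_mul_I

theorem IsSchwarzMap.trace_map_mul (hΦ : IsSchwarzMap Φ) (X : Matrix (Fin m) (Fin m) ℂ)
    (Y : Matrix (Fin n) (Fin n) ℂ) : (Φ X * Y).trace = (X * hsAdjoint Φ Y).trace := by
  have h := hsInner_hsAdjoint Φ Xᴴ Y
  rw [hsInner, hsInner, hΦ.map_conjTranspose, Matrix.conjTranspose_conjTranspose,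
    Matrix.conjTranspose_conjTranspose] at h
  exact h.symm

theorem IsSchwarzMap.posSemidef_hsAdjoint (hΦ : IsSchwarzMap Φ) {P : Matrix (Fin n) (Fin n) ℂ}
    (hP : P.PosSemidef) : (hsAdjoint Φ P).PosSemidef := by
  refine Matrix.PosSemidef.of_dotProduct_mulVec_nonneg ?_ fun x => ?_
  · ext i j
    rw [Matrix.conjTranspose_apply]
    change star (hsInner (Φ (Matrix.single j i 1)) P) = hsInner (Φ (Matrix.single i j 1)) P
    rw [hsInner, hsInner, ← Matrix.trace_conjTranspose, Matrix.conjTranspose_mul,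
      Matrix.conjTranspose_conjTranspose, hP.1.eq, Matrix.trace_mul_comm,
      ← hΦ.map_conjTranspose, Matrix.conjTranspose_single, star_one]
  · have h : star x ⬝ᵥ hsAdjoint Φ P *ᵥ x =
        (Φ (Matrix.vecMulVec x (star x)) * P).trace := by
      rw [hΦ.trace_map_mul, Matrix.trace_mul_comm, Matrix.mul_vecMulVec, Matrix.trace_vecMulVec,
        dotProduct_comm]
    rw [h]
    refine trace_mul_nonneg_of_posSemidef ?_ hP
    -- The rank-one projector is written as a square `S*S`, the form in which positivity of `Φ` is
    -- known.
    have hX := Matrix.posSemidef_vecMulVec_self_star x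
    have hs : CFC.sqrt (Matrix.vecMulVec x (star x)) * CFC.sqrt (Matrix.vecMulVec x (star x)) =
        Matrix.vecMulVec x (star x) :=
      CFC.sqrt_mul_sqrt_self _ (Matrix.nonneg_iff_posSemidef.2 hX)
    have hs' := (Matrix.nonneg_iff_posSemidef.1
      (CFC.sqrt_nonneg (Matrix.vecMulVec x (star x)))).1
    have := hΦ.posSemidef_map_conjTranspose_mul_self (CFC.sqrt (Matrix.vecMulVec x (star x)))
    rwa [hs'.eq, hs] at this

theorem exists_pos_posSemidef_sub_smul_one {A : Matrix (Fin n) (Fin n) ℂ} (hn : 0 < n)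
    (hA : A.PosDef) : ∃ c : ℝ, 0 < c ∧ (A - (c : ℂ) • 1).PosSemidef := by
  obtain ⟨U, d, hU, hU', -, hd, h⟩ := exists_unitary_rpow_eq hA.posSemidef
  have := Fin.pos_iff_nonempty.1 hn
  obtain ⟨i₀, hi₀⟩ := Finite.exists_min d
  refine ⟨d i₀, hd hA i₀, ?_⟩
  have hA1 : A = U * Matrix.diagonal (fun i => (d i : ℂ)) * Uᴴ := by
    simpa [(rpow_one_and_rpow_zero hA.posSemidef).1] using h 1
  have e : A - (d i₀ : ℂ) • 1 =
      U * Matrix.diagonal (fun i => ((d i - d i₀ : ℝ) : ℂ)) * Uᴴ := by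
    have : Matrix.diagonal (fun i => ((d i - d i₀ : ℝ) : ℂ)) =
        Matrix.diagonal (fun i => (d i : ℂ)) - (d i₀ : ℂ) • 1 := by
      ext i j
      by_cases hij : i = j
      · subst hij; simp
      · simp [hij]
    rw [this, mul_sub, sub_mul, ← hA1, mul_smul_comm, mul_one, smul_mul_assoc, hU]
  rw [e]
  refine Matrix.PosSemidef.mul_mul_conjTranspose_same (Matrix.PosSemidef.diagonal ?_) U
  intro i
  simpa using hi₀ i

/-- From `A ≥ c 1` with `c > 0`, positivity and semiunitality give `Φ†(A) ≥ c (n/m) 1`. -/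
theorem IsSchwarzMap.posDef_hsAdjoint (hΦ : IsSchwarzMap Φ) (hs : IsSemiunital Φ)
    (hm : 0 < m) (hn : 0 < n) {A : Matrix (Fin n) (Fin n) ℂ} (hA : A.PosDef) :
    (hsAdjoint Φ A).PosDef := by
  obtain ⟨c, hc, h⟩ := exists_pos_posSemidef_sub_smul_one hn hA
  have e : hsAdjoint Φ A = hsAdjoint Φ (A - (c : ℂ) • 1) +
      ((c * (n / m) : ℝ) : ℂ) • (1 : Matrix (Fin m) (Fin m) ℂ) := by
    rw [map_sub, map_smul, hs, smul_smul]
    push_cast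
    rw [sub_add_cancel]
  rw [e]
  refine Matrix.PosDef.posSemidef_add (hΦ.posSemidef_hsAdjoint h) (Matrix.PosDef.one.smul ?_)
  have : 0 < c * (n / m) := by positivity
  exact_mod_cast this

/-- The Schwarz inequality for `K*`, namely `Φ(K) Φ(K)* ≤ Φ(K K*)`, paired with `A`. -/
theorem IsSchwarzMap.powerForm_one_zero_le (hΦ : IsSchwarzMap Φ)
    {A C : Matrix (Fin n) (Fin n) ℂ} (hA : A.PosSemidef) (hC : C.PosSemidef)
    (K : Matrix (Fin m) (Fin m) ℂ) :
    powerForm A C 1 0 (Φ K) ≤ 1 * powerForm (hsAdjoint Φ A) (hsAdjoint Φ C) 1 0 K := by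
  rw [powerForm, powerForm, (rpow_one_and_rpow_zero hA).1, (rpow_one_and_rpow_zero hC).2,
    (rpow_one_and_rpow_zero (hΦ.posSemidef_hsAdjoint hA)).1,
    (rpow_one_and_rpow_zero (hΦ.posSemidef_hsAdjoint hC)).2, mul_one, mul_one, one_mul,
    Matrix.trace_mul_cycle (Φ K)ᴴ, Matrix.trace_mul_cycle Kᴴ, ← hΦ.trace_map_mul]
  have h := hΦ Kᴴ
  rw [Matrix.conjTranspose_conjTranspose, hΦ.map_conjTranspose,
    Matrix.conjTranspose_conjTranspose] at h
  have h' := trace_mul_nonneg_of_posSemidef h hA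
  rw [sub_mul, Matrix.trace_sub] at h'
  simpa using (Complex.le_def.1 h').1

/-- The Schwarz inequality for `K`, paired with `C`. -/
theorem IsSchwarzMap.powerForm_zero_one_le (hΦ : IsSchwarzMap Φ)
    {A C : Matrix (Fin n) (Fin n) ℂ} (hA : A.PosSemidef) (hC : C.PosSemidef)
    (K : Matrix (Fin m) (Fin m) ℂ) :
    powerForm A C 0 1 (Φ K) ≤ 1 * powerForm (hsAdjoint Φ A) (hsAdjoint Φ C) 0 1 K := by
  rw [powerForm, powerForm, (rpow_one_and_rpow_zero hA).2, (rpow_one_and_rpow_zero hC).1,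
    (rpow_one_and_rpow_zero (hΦ.posSemidef_hsAdjoint hA)).2,
    (rpow_one_and_rpow_zero (hΦ.posSemidef_hsAdjoint hC)).1, mul_one, mul_one, one_mul,
    ← hΦ.trace_map_mul]
  have h' := trace_mul_nonneg_of_posSemidef (hΦ K) hC
  rw [sub_mul, Matrix.trace_sub] at h'
  simpa using (Complex.le_def.1 h').1

/-- The trace of the Schwarz inequality; semiunitality supplies the constant. -/
theorem IsSchwarzMap.powerForm_zero_zero_le (hΦ : IsSchwarzMap Φ) (hs : IsSemiunital Φ)
    {A C : Matrix (Fin n) (Fin n) ℂ} (hA : A.PosSemidef) (hC : C.PosSemidef)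
    (K : Matrix (Fin m) (Fin m) ℂ) :
    powerForm A C 0 0 (Φ K) ≤ (n / m : ℝ) * powerForm (hsAdjoint Φ A) (hsAdjoint Φ C) 0 0 K := by
  rw [powerForm, powerForm, (rpow_one_and_rpow_zero hA).2, (rpow_one_and_rpow_zero hC).2,
    (rpow_one_and_rpow_zero (hΦ.posSemidef_hsAdjoint hA)).2,
    (rpow_one_and_rpow_zero (hΦ.posSemidef_hsAdjoint hC)).2, mul_one, mul_one, mul_one, mul_one]
  have h' := (hΦ K).trace_nonneg
  have e := hΦ.trace_map_mul (Kᴴ * K) 1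
  rw [hs, mul_one, mul_smul_comm, mul_one, Matrix.trace_smul, smul_eq_mul] at e
  rw [Matrix.trace_sub, e] at h'
  have h2 := (Complex.le_def.1 h').1
  have e2 : ((n : ℂ) / m) = ((n / m : ℝ) : ℂ) := by push_cast; rfl
  rw [e2, Complex.sub_re, Complex.re_ofReal_mul] at h2
  simpa using h2

theorem IsSchwarzMap.weightedBound (hΦ : IsSchwarzMap Φ) (hs : IsSemiunital Φ)
    (hm : 0 < m) (hn : 0 < n) {A C : Matrix (Fin n) (Fin n) ℂ} (hA : A.PosDef) (hC : C.PosDef)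
    {s r : ℝ} (hs0 : 0 ≤ s) (hs1 : s < 1) (hr : 0 ≤ r) (hsr : s + r ≤ 1) :
    WeightedBound Φ A C (hsAdjoint Φ A) (hsAdjoint Φ C) s r ((n / m : ℝ) ^ (1 - s - r)) := by
  have hA' := hΦ.posDef_hsAdjoint hs hm hn hA
  have hC' := hΦ.posDef_hsAdjoint hs hm hn hC
  have hk : (0 : ℝ) < n / m := by positivity
  have h10 := weightedBound_of_powerForm_le hA hC
    (hΦ.powerForm_one_zero_le hA.posSemidef hC.posSemidef)
  have h01 := weightedBound_of_powerForm_le hA hC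
    (hΦ.powerForm_zero_one_le hA.posSemidef hC.posSemidef)
  have h00 := weightedBound_of_powerForm_le hA hC
    (hΦ.powerForm_zero_zero_le hs hA.posSemidef hC.posSemidef)
  have hs' : 0 < 1 - s := by linarith
  -- Interpolate from `(0,0)` towards `(0,1)` up to `(0, r/(1-s))`, then a fraction `s` of the way
  -- to `(1,0)`; this lands on `(s,r)`.
  have h0 := h00.interpolate hA hC hA' hC' hk one_pos h01 (θ := r / (1 - s)) (by positivity)
    (by rw [div_le_one hs']; linarith)
  have h1 := h0.interpolate hA hC hA' hC' (by positivity) one_pos h10 hs0 hs1.le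
  convert h1 using 1
  · ring
  · field_simp
    ring
  · rw [Real.one_rpow, Real.one_rpow, mul_one, mul_one, ← Real.rpow_mul hk.le]
    congr 1
    field_simp

theorem trace_sandwich_inverse {P P' Q Q' X Y : Matrix (Fin m) (Fin m) ℂ}
    (hP : P * P' = 1) (hQ : Q * Q' = 1) :
    (Q * Y * P * P' * (P * X * Q) * Q').trace = (Y * P * X * Q).trace := by
  have h : Q * Y * P * P' * (P * X * Q) * Q' = Q * (Y * P * X) := by
    calc Q * Y * P * P' * (P * X * Q) * Q' = Q * Y * (P * P') * P * X * (Q * Q') := by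
          simp only [Matrix.mul_assoc]
      _ = Q * (Y * P * X) := by rw [hP, hQ]; simp only [mul_one, Matrix.mul_assoc]
  rw [h, Matrix.trace_mul_comm]

/-- Monotonicity form of the Lieb--Ando joint convexity theorem for Schwarz maps. -/
theorem IsSchwarzMap.powerForm_hsAdjoint_le (hΦ : IsSchwarzMap Φ) (hs : IsSemiunital Φ)
    (hm : 0 < m) (hn : 0 < n) {A C : Matrix (Fin n) (Fin n) ℂ} (hA : A.PosDef) (hC : C.PosDef)
    {s r : ℝ} (hs0 : 0 ≤ s) (hs1 : s < 1) (hr : 0 ≤ r) (hsr : s + r ≤ 1)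
    (B : Matrix (Fin n) (Fin n) ℂ) :
    powerForm (hsAdjoint Φ A) (hsAdjoint Φ C) (-s) (-r) (hsAdjoint Φ B) ≤
      (n / m : ℝ) ^ (1 - s - r) * powerForm A C (-s) (-r) B := by
  have hA' := hΦ.posDef_hsAdjoint hs hm hn hA
  have hC' := hΦ.posDef_hsAdjoint hs hm hn hC
  have hb := hΦ.weightedBound hs hm hn hA hC hs0 hs1 hr hsr
  set A' := hsAdjoint Φ A
  set C' := hsAdjoint Φ C
  set X := hsAdjoint Φ B with hX
  -- The extremizer for the dual weights: it makes both `tr[K* X]` and the form of `K` equal to the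
  -- form of `X`.
  set K := A' ^ (-s) * X * C' ^ (-r) with hK
  have hAh : (A' ^ (-s))ᴴ = A' ^ (-s) := (Matrix.nonneg_iff_posSemidef.1 CFC.rpow_nonneg).1
  have hCh : (C' ^ (-r))ᴴ = C' ^ (-r) := (Matrix.nonneg_iff_posSemidef.1 CFC.rpow_nonneg).1
  have hKh : Kᴴ = C' ^ (-r) * Xᴴ * A' ^ (-s) := by
    rw [hK, Matrix.conjTranspose_mul, Matrix.conjTranspose_mul, hAh, hCh, Matrix.mul_assoc]
  have hAi : A' ^ (-s) * A' ^ s = 1 :=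
    CFC.rpow_neg_mul_rpow s (Matrix.isStrictlyPositive_iff_posDef.2 hA')
  have hCi : C' ^ (-r) * C' ^ r = 1 :=
    CFC.rpow_neg_mul_rpow r (Matrix.isStrictlyPositive_iff_posDef.2 hC')
  have hKX : (Kᴴ * X).trace = (Xᴴ * A' ^ (-s) * X * C' ^ (-r)).trace := by
    rw [hKh, Matrix.mul_assoc, Matrix.mul_assoc, Matrix.trace_mul_comm]
    simp only [Matrix.mul_assoc]
  have h1 : ‖(Bᴴ * Φ K).trace‖ = ‖(Kᴴ * X).trace‖ := by
    have h := hsInner_hsAdjoint Φ K B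
    rw [hsInner, hsInner, ← hX] at h
    rw [h, ← norm_star, ← Matrix.trace_conjTranspose, Matrix.conjTranspose_mul,
      Matrix.conjTranspose_conjTranspose]
  have h2 : powerForm A' C' s r K = powerForm A' C' (-s) (-r) X := by
    rw [powerForm, powerForm, hKh, hK, trace_sandwich_inverse hAi hCi]
  have h3 : powerForm A' C' (-s) (-r) X ≤ ‖(Kᴴ * X).trace‖ := by
    rw [hKX, powerForm]
    exact Complex.re_le_norm _
  have h4 := h3.trans (h1.symm.le.trans (hb B K))
  rw [h2] at h4
  have hN := powerForm_nonneg hA' hC' (-s) (-r) X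
  have hM := powerForm_nonneg hA hC (-s) (-r) B
  have hk : 0 ≤ (n / m : ℝ) ^ (1 - s - r) := by positivity
  generalize powerForm A' C' (-s) (-r) X = N at *
  generalize powerForm A C (-s) (-r) B = M at *
  generalize (n / m : ℝ) ^ (1 - s - r) = k at *
  have hkM : 0 ≤ k * M := mul_nonneg hk hM
  -- Now `N² ≤ M k N`, so one factor `N` cancels, trivially when `N = 0`.
  have h5 := (Real.le_sqrt hN (by positivity)).1 h4
  by_contra! hlt
  nlinarith

end Schwarz

/-! ### The trace Young inequality. -/

theorem rpow_le_weighted_young {z d t q : ℝ} (hz : 0 ≤ z) (hd : 0 < d) (ht : 0 < t)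
    (hq0 : 0 < q) (hq1 : q ≤ 1) :
    z ^ q ≤ q * t ^ (-(1 / q - 1)) * (z * d ^ (-(1 / q - 1))) + (1 - q) * t * d := by
  -- The two points are chosen so that the powers of `t * d` cancel in the geometric mean, leaving
  -- `z ^ q`.
  have h := Real.geom_mean_le_arith_mean2_weighted hq0.le (sub_nonneg.2 hq1)
    (p₁ := z * (t * d) ^ (-(1 / q - 1))) (p₂ := t * d) (by positivity) (by positivity) (by ring)
  have htd : 0 < t * d := mul_pos ht hd
  rw [Real.mul_rpow hz (by positivity), ← Real.rpow_mul htd.le, mul_assoc, ← Real.rpow_add htd,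
    show -(1 / q - 1) * q + (1 - q) = 0 by field_simp; ring, Real.rpow_zero, mul_one,
    Real.mul_rpow ht.le hd.le] at h
  linarith

/-- The trace Young inequality behind the variational formula for `tr[Z^q]`. -/
theorem trace_rpow_le {m : ℕ} {Z D : Matrix (Fin m) (Fin m) ℂ} (hZ : Z.PosSemidef)
    (hD : D.PosDef) {t q : ℝ} (ht : 0 < t) (hq0 : 0 < q) (hq1 : q ≤ 1) :
    (Z ^ q).trace.re ≤ q * t ^ (-(1 / q - 1)) * (Z * D ^ (-(1 / q - 1))).trace.re +
      (1 - q) * t * D.trace.re := by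
  obtain ⟨U, z, -, -, hz, -, hUz⟩ := exists_unitary_rpow_eq hZ
  obtain ⟨V, d, -, -, -, hd, hVd⟩ := exists_unitary_rpow_eq hD.posSemidef
  -- All three traces become sums against the same overlaps `|(U* V)_{ij}|²`, so the scalar
  -- inequality applies termwise.
  have h : ∀ a b : ℝ, (Z ^ a * D ^ b).trace.re =
      ∑ i, ∑ j, z i ^ a * d j ^ b * ‖(Uᴴ * (1 : Matrix (Fin m) (Fin m) ℂ) * V) i j‖ ^ 2 := by
    intro a b
    have := trace_sandwich_eq_sum U V 1 (fun i => z i ^ a) (fun j => d j ^ b)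
    rw [← hUz, ← hVd, Matrix.conjTranspose_one, one_mul, mul_one] at this
    rw [this, Complex.ofReal_re]
  have h1 := h q 0
  have h2 := h 1 (-(1 / q - 1))
  have h3 := h 0 1
  rw [(rpow_one_and_rpow_zero hD.posSemidef).2, mul_one] at h1
  rw [(rpow_one_and_rpow_zero hZ).1] at h2
  rw [(rpow_one_and_rpow_zero hZ).2, (rpow_one_and_rpow_zero hD.posSemidef).1, one_mul] at h3
  rw [h1, h2, h3, Finset.mul_sum, Finset.mul_sum, ← Finset.sum_add_distrib]
  refine Finset.sum_le_sum fun i _ => ?_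
  rw [Finset.mul_sum, Finset.mul_sum, ← Finset.sum_add_distrib]
  refine Finset.sum_le_sum fun j _ => ?_
  have hy := mul_le_mul_of_nonneg_right (rpow_le_weighted_young (hz i) (hd hD j) ht hq0 hq1)
    (sq_nonneg ‖(Uᴴ * (1 : Matrix (Fin m) (Fin m) ℂ) * V) i j‖)
  simp only [Real.rpow_zero, Real.rpow_one, mul_one, one_mul] at hy ⊢
  linarith

theorem trace_eq_ofReal_re {n : ℕ} {A : Matrix (Fin n) (Fin n) ℂ} (hA : A.PosSemidef) :
    A.trace = (A.trace.re : ℂ) := by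
  have h := (Complex.le_def.1 hA.trace_nonneg).2
  exact Complex.ext rfl (by simpa using h.symm)

end SesquiunitalSchwarz

/-! ### The main inequality. -/

open SesquiunitalSchwarz

/-- Real powers of matrices are taken in the continuous functional calculus (`CFC.rpow`), and the
inequality between traces is that of `ℂ`, so that it includes that both sides are real. -/
theorem theorem4p4 (m n : ℕ) (hm : 0 < m) (hn : 0 < n) (s q : ℝ)
    (hs0 : 0 ≤ s) (hs1 : s < 1) (hq : 1 / (2 - s) ≤ q) (hq1 : q < 1)
    (Φ : Matrix (Fin m) (Fin m) ℂ →ₗ[ℂ] Matrix (Fin n) (Fin n) ℂ)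
    (hΦ : SesquiunitalSchwarz.IsSchwarzMap Φ)
    (hΦ1 : SesquiunitalSchwarz.IsSesquiunital Φ)
    (A : Matrix (Fin n) (Fin n) ℂ) (hA : A.PosDef)
    (B : Matrix (Fin n) (Fin n) ℂ) (hB : IsUnit B) :
    ((((n : ℝ) / (m : ℝ)) ^ ((2 - s) * q - 1) : ℝ) : ℂ) *
        ((Bᴴ * A ^ (-s) * B) ^ q).trace ≥
      (((SesquiunitalSchwarz.hsAdjoint Φ B)ᴴ * (SesquiunitalSchwarz.hsAdjoint Φ A) ^ (-s) *
        SesquiunitalSchwarz.hsAdjoint Φ B) ^ q).trace := by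
  obtain ⟨hu, hsu⟩ := hΦ1
  have hq0 : 0 < q := lt_of_lt_of_le (by have : 0 < 2 - s := by linarith
                                         positivity) hq
  have hpos : ∀ {k : ℕ} {X : Matrix (Fin k) (Fin k) ℂ} (a : ℝ), X.PosDef → (X ^ a).PosDef := by
    intro k X a hX
    refine ((Matrix.nonneg_iff_posSemidef.1 CFC.rpow_nonneg).posDef_iff_isUnit).2 ?_
    have h := CFC.rpow_neg_mul_rpow a (Matrix.isStrictlyPositive_iff_posDef.2 hX)
    exact IsUnit.of_mul_eq_one_right _ h
  set Z := Bᴴ * A ^ (-s) * B with hZdef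
  set Z' := (hsAdjoint Φ B)ᴴ * (hsAdjoint Φ A) ^ (-s) * hsAdjoint Φ B with hZ'def
  have hZ : Z.PosDef := by
    refine (((hpos (-s) hA).posSemidef.conjTranspose_mul_mul_same B).posDef_iff_isUnit).2 ?_
    exact (((Matrix.isUnit_conjTranspose _).2 hB).mul (hpos (-s) hA).isUnit).mul hB
  have hZ' : Z'.PosSemidef :=
    (Matrix.nonneg_iff_posSemidef.1 CFC.rpow_nonneg).conjTranspose_mul_mul_same _
  have hC := hpos q hZ
  have hC' := hΦ.posDef_hsAdjoint hsu hm hn hC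
  set r := 1 / q - 1 with hr
  have hr0 : 0 ≤ r := by
    rw [hr, sub_nonneg, le_div_iff₀ hq0]
    linarith
  have hsr : s + r ≤ 1 := by
    rw [div_le_iff₀ (by linarith)] at hq
    have : 1 / q ≤ 2 - s := by rw [div_le_iff₀ hq0]; linarith
    linarith
  have hk : (0 : ℝ) < n / m := by positivity
  -- This `t` solves `t^{-r} (n/m)^{1-s-r} = t`, so the two Young terms add up to `q t + (1-q) t =
  -- t` times `tr[Z^q]`.
  set t := ((n : ℝ) / m) ^ ((2 - s) * q - 1) with ht
  have ht0 : 0 < t := Real.rpow_pos_of_pos hk _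
  have hyoung := trace_rpow_le hZ' hC' ht0 hq0 hq1.le
  have hmono := hΦ.powerForm_hsAdjoint_le hsu hm hn hA hC hs0 hs1 hr0 hsr B
  have htr : (hsAdjoint Φ (Z ^ q)).trace = (Z ^ q).trace := by
    have := hΦ.trace_map_mul 1 (Z ^ q)
    rw [hu, one_mul, one_mul] at this
    exact this.symm
  have hZC : Z * (Z ^ q) ^ (-r) = Z ^ q := by
    have hZs := Matrix.isStrictlyPositive_iff_posDef.2 hZ
    rw [CFC.rpow_rpow Z q (-r) hq0.ne' hZs]
    nth_rewrite 1 [← CFC.rpow_one Z hZs.nonneg]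
    rw [← CFC.rpow_add hZ.isUnit]
    congr 1
    rw [hr]
    field_simp
    ring
  rw [powerForm, powerForm, ← hZdef, ← hZ'def, hZC] at hmono
  rw [htr] at hyoung
  have hkt : t ^ (-r) * (n / m : ℝ) ^ (1 - s - r) = t := by
    rw [ht, ← Real.rpow_mul hk.le, ← Real.rpow_add hk]
    congr 1
    rw [hr]
    field_simp
    ring
  have hfin : (Z' ^ q).trace.re ≤ t * (Z ^ q).trace.re := by
    have h1 := mul_le_mul_of_nonneg_left hmono
      (mul_nonneg hq0.le (Real.rpow_pos_of_pos ht0 (-r)).le)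
    have h2 : q * t ^ (-r) * ((n / m : ℝ) ^ (1 - s - r) * (Z ^ q).trace.re) =
        q * t * (Z ^ q).trace.re := by
      linear_combination (q * (Z ^ q).trace.re) * hkt
    linarith
  rw [ge_iff_le, trace_eq_ofReal_re hC.posSemidef,
    trace_eq_ofReal_re (Matrix.nonneg_iff_posSemidef.1 (CFC.rpow_nonneg (a := Z') (y := q)))]
  exact_mod_cast hfin
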